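/- Let $p$ be a prime, $p^*=p$ if $p>2$ and $p^*=4$ if $p=2$. Let $q\in\mathbb C_p$ with $q\ne1$ and $|1-q|_p<p^{-1/(p-1)}$. Write $\exp$ for the $p$-adic exponential series, $\log_p$ for the $p$-adic logarithm, $u^x=\exp(x\log_p u)$, and $[x]_q=\frac{1-q^x}{1-q}$. The $q$-Bernoulli numbers are defined by $\beta_{0,q}=\frac{q-1}{\log_p q}$ and $\sum_{i=0}^n\binom ni q^i\beta_{i,q}-\beta_{n,q}=\delta_{n,1}$ for $n\ge1$. Let $w$ be the Teichmüller character, and put $\langle a+p^*t\rangle=w(a)^{-1}[a+p^*t]_q$ for integers $a$ prime to $p$ and $t\in\mathbb C_p$ with $|t|_p\le1$. Let $\chi\ne1$ be a primitive Dirichlet character with conductor $f$ and values in $\mathbb C_p$, let $F$ be a positive common multiple of $p^*$ and $f$, and for $s\neq1$ in $\mathbb C_p$ with $|s-1|_p\le1$ let $$L_{p,q}(s,t|\chi)=\frac1{s-1}\,\frac1{[F]_q}\sum_{\substack{1\le a\le F\\(a,p)=1}}\chi(a)\,\langle a+p^*t\rangle^{1-s}\sum_{m=0}^\infty\binom{1-s}m\beta_{m,q^F}\,q^{(a+p^*t)m}\left[\frac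 F{a+p^*t}\right]_{q^{a+p^*t}}^m .$$ Then, for every $t\in\mathbb C_p$ with $|t|_p\le1$, the series in this definition converge for all $s\in\mathbb C_p$ with $|s-1|_p\le1$, the limit $L_{p,q}(1,t|\chi):=\lim_{s\to1}L_{p,q}(s,t|\chi)$ exists, and $$L_{p,q}(1,t|\chi)=\frac1{[F]_q}\sum_{\substack{1\le a\le F\\(a,p)=1}}\chi(a)\left\{-\beta_{0,q^F}\log_p\langle a+p^*t\rangle+\sum_{m=1}^\infty\frac{(-1)^m}m\,\beta_{m,q^F}\,q^{(a+p^*t)m}\left(\frac{[F]_q}{[a+p^*t]_q}\right)^m\right\},$$ where the series on the right converge. -/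

import Mathlib

open Filter Topology

noncomputable section

namespace KimPadicL

variable {p : ℕ} [Fact p.Prime]

/-- `p^* = p` for odd `p`, and `2^* = 4`. -/
def pStar (p : ℕ) : ℕ := if p = 2 then 4 else p

/-- The `p`-adic logarithm `log_p x = ∑_{n ≥ 1} (-1)^{n-1} (x - 1)^n / n`, for `‖x - 1‖ < 1`.
Only arguments in this disc occur below. -/
def plog (x : ℂ_[p]) : ℂ_[p] :=
  ∑' n : ℕ, (-1) ^ n * (x - 1) ^ (n + 1) / ((n + 1 : ℕ) : ℂ_[p])

/-- `u ^ x = exp (x log u)`, for a base `u` close to `1` and a `p`-adic exponent `x`. -/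
def ppow (u x : ℂ_[p]) : ℂ_[p] := NormedSpace.exp (x * plog u)

/-- The `q`-number `[x]_q = (1 - q^x) / (1 - q)`. -/
def qNum (q x : ℂ_[p]) : ℂ_[p] := (1 - ppow q x) / (1 - q)

/-- The `q`-Bernoulli numbers, given by `β_{0,q} = (q - 1) / log q` and, for `n ≥ 1`,
`∑_{i ≤ n} (n choose i) q^i β_{i,q} - β_{n,q} = δ_{n,1}`, solved for `β_{n,q}`. -/
def qBernoulli (q : ℂ_[p]) : ℕ → ℂ_[p]
  | 0 => (q - 1) / plog q
  | n + 1 =>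
    ((if n + 1 = 1 then 1 else 0)
      - ∑ i : Fin (n + 1), ((n + 1).choose i : ℂ_[p]) * q ^ (i : ℕ) * qBernoulli q i)
      / (q ^ (n + 1) - 1)

/-- The values of the Teichmüller character (of conductor `p^*`) at natural numbers: for odd `p`,
`w(a) = lim a^(p^n)`; for `p = 2`, `w(a) = ±1` is congruent to `a` modulo `4` (for `a` odd). -/
def teich (p : ℕ) [Fact p.Prime] (a : ℕ) : ℂ_[p] :=
  if p = 2 then ((ZMod.χ₄ (a : ZMod 4) : ℤ) : ℂ_[p])
  else limUnder atTop (fun n : ℕ => (a : ℂ_[p]) ^ p ^ n)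

/-- The point `a + p^* t`. -/
def pt (a : ℕ) (t : ℂ_[p]) : ℂ_[p] := (a : ℂ_[p]) + (pStar p : ℂ_[p]) * t

/-- `⟨a + p^* t⟩ = w(a)⁻¹ [a + p^* t]_q`. -/
def angle (q : ℂ_[p]) (a : ℕ) (t : ℂ_[p]) : ℂ_[p] := (teich p a)⁻¹ * qNum q (pt a t)

/-- The integers `1 ≤ a ≤ F` with `(a, p) = 1`. -/
def units (p F : ℕ) : Finset ℕ := (Finset.Icc 1 F).filter (fun a => Nat.Coprime a p)

/-- The `m`-th term of the series in the definition of the two-variable `p`-adic `q`-`L`-function: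
`(1-s choose m) β_{m,q^F} q^{(a + p^* t) m} ([F / (a + p^* t)]_{q^{a + p^* t}})^m`. -/
def LTerm (q : ℂ_[p]) (F a : ℕ) (s t : ℂ_[p]) (m : ℕ) : ℂ_[p] :=
  Ring.choose (1 - s) m * qBernoulli (q ^ F) m * ppow q (pt a t * (m : ℂ_[p]))
    * qNum (ppow q (pt a t)) ((F : ℂ_[p]) / pt a t) ^ m

/-- The formula that defines the two-variable `p`-adic `q`-`L`-function at `s ≠ 1`. -/
def LFormula (q : ℂ_[p]) {f : ℕ} (χ : DirichletCharacter ℂ_[p] f) (F : ℕ) (s t : ℂ_[p]) :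
    ℂ_[p] :=
  1 / (s - 1) * (1 / qNum q (F : ℂ_[p]))
    * ∑ a ∈ units p F, χ (a : ZMod f) * ppow (angle q a t) (1 - s) * ∑' m : ℕ, LTerm q F a s t m

open Classical in
/-- The two-variable `p`-adic `q`-`L`-function `L_{p,q}(s, t | χ)`. At `s = 1` its value is the
limit of the defining formula. -/
def L (q : ℂ_[p]) {f : ℕ} (χ : DirichletCharacter ℂ_[p] f) (F : ℕ) (s t : ℂ_[p]) : ℂ_[p] :=
  if s = 1 then limUnder (𝓝[≠] (1 : ℂ_[p])) (fun s' => LFormula q χ F s' t)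
  else LFormula q χ F s t

/-- The term of index `m + 1` of the series in the value at `s = 1`, namely
`((-1)^k / k) β_{k,q^F} q^{(a + p^* t) k} ([F]_q / [a + p^* t]_q)^k` with `k = m + 1`. -/
def oneTerm (q : ℂ_[p]) (F a : ℕ) (t : ℂ_[p]) (m : ℕ) : ℂ_[p] :=
  (-1) ^ (m + 1) / ((m + 1 : ℕ) : ℂ_[p]) * qBernoulli (q ^ F) (m + 1)
    * ppow q (pt a t * ((m + 1 : ℕ) : ℂ_[p]))
    * (qNum q (F : ℂ_[p]) / qNum q (pt a t)) ^ (m + 1)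

end KimPadicL

end

/-! The nontrivial character `χ` sums to zero over the `a ≤ F` prime to `p`, so `β_{0,q^F}` can be
subtracted from every summand (`sum_units_dirichletCharacter`). Each summand then becomes a
difference quotient at `s = 1` (`tendsto_summand_slope`): the power of `⟨a + p^* t⟩` yields the
logarithm, and `(1-s choose m) / (1-s) → (-1)^(m-1) / m` yields the series.

The termwise limit needs a bound uniform in `s`. With `r = p^(-1/(p-1))`, the binomial quotients are
at most about `r^(-m)`, while `[F]_q / [a + p^* t]_q` has norm `‖F‖ < r`; polynomial growth of
`β_{m,q^F}` therefore suffices. The recursion divides by `q^n - 1` and hides this. Instead,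
`β_{n,q}` is `β_{0,q}` times the Volkenborn integral of `[x]_q^n`, that is `β_{0,q} ∑ (-1)^k / (k+1)
a_k` with `a_k` the Mahler coefficients (`hasSum_qBernoulli`). These are integral and decay
geometrically beyond `k = n`, whence `‖β_{n,q}‖ ≤ n + 1` (`norm_qBernoulli_le`). -/

noncomputable section

namespace KimPadicL

variable {p : ℕ} [Fact p.Prime]

/-! ### The exponential radius and norms of integers and factorials -/

/-- The radius of convergence `p ^ (-1 / (p - 1))` of the `p`-adic exponential series. -/
def expRadius (p : ℕ) : ℝ := (p : ℝ) ^ (-(1 / ((p : ℝ) - 1)))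

lemma one_lt_cast_prime (p : ℕ) [Fact p.Prime] : (1 : ℝ) < p :=
  mod_cast (Fact.out : p.Prime).one_lt

lemma expRadius_pos (p : ℕ) [Fact p.Prime] : 0 < expRadius p :=
  Real.rpow_pos_of_pos (by linarith [one_lt_cast_prime p]) _

lemma expRadius_lt_one (p : ℕ) [Fact p.Prime] : expRadius p < 1 := by
  have h := one_lt_cast_prime p
  refine Real.rpow_lt_one_of_one_lt_of_neg h ?_
  have : 0 < 1 / ((p : ℝ) - 1) := by
    apply one_div_pos.mpr
    linarith
  linarith

lemma expRadius_pow (p : ℕ) [Fact p.Prime] : expRadius p ^ (p - 1) = (p : ℝ)⁻¹ := by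
  have h := one_lt_cast_prime p
  have h' : (p : ℝ) - 1 ≠ 0 := by linarith
  rw [expRadius, ← Real.rpow_natCast, ← Real.rpow_mul (by linarith),
    Nat.cast_sub (Fact.out : p.Prime).one_lt.le, Nat.cast_one]
  rw [show -(1 / ((p : ℝ) - 1)) * ((p : ℝ) - 1) = -1 by field_simp, Real.rpow_neg_one]

lemma norm_natCast_eq (n : ℕ) : ‖(n : ℂ_[p])‖ = ‖(n : ℚ_[p])‖ := by
  rw [← PadicComplex.norm_extends' p (n : ℚ_[p])]
  congr 1
  rw [map_natCast]
  exact (PadicComplex.coe_natCast p n).symm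

lemma norm_natCast_le_one (n : ℕ) : ‖(n : ℂ_[p])‖ ≤ 1 :=
  IsUltrametricDist.norm_natCast_le_one _ n

lemma norm_cast_prime : ‖(p : ℂ_[p])‖ = (p : ℝ)⁻¹ := by
  rw [norm_natCast_eq, Padic.norm_p]

lemma norm_natCast_eq_one_of_coprime {a : ℕ} (h : a.Coprime p) : ‖(a : ℂ_[p])‖ = 1 := by
  rw [norm_natCast_eq]
  exact Padic.norm_natCast_eq_one_iff.mpr h.symm

/-- Legendre's formula gives `(p-1) v_p((n+1)!) ≤ n`, and `r^(p-1) = 1/p` for the radius `r`. -/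
lemma expRadius_pow_le_norm_factorial (n : ℕ) :
    expRadius p ^ n ≤ ‖((n + 1).factorial : ℂ_[p])‖ := by
  have hv := sub_one_mul_padicValNat_factorial_lt_of_ne_zero (p := p) (n := n + 1) (by omega)
  rw [norm_natCast_eq, Padic.norm_eq_zpow_neg_valuation
    (mod_cast (n + 1).factorial_ne_zero), Padic.valuation_natCast, zpow_neg, zpow_natCast,
    ← inv_pow, ← expRadius_pow, ← pow_mul]
  exact pow_le_pow_of_le_one (expRadius_pos p).le (expRadius_lt_one p).le (by omega)

lemma norm_factorial_le (n : ℕ) :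
    ‖((n + 1).factorial : ℂ_[p])‖ ≤ ‖((n + 1 : ℕ) : ℂ_[p])‖ := by
  rw [Nat.factorial_succ, Nat.cast_mul, norm_mul]
  exact mul_le_of_le_one_right (norm_nonneg _) (norm_natCast_le_one _)

lemma inv_norm_natCast_le (n : ℕ) : ‖(((n + 1 : ℕ) : ℂ_[p]))⁻¹‖ ≤ n + 1 := by
  rw [norm_inv, norm_natCast_eq, Padic.norm_eq_zpow_neg_valuation (mod_cast n.succ_ne_zero),
    Padic.valuation_natCast, zpow_neg, zpow_natCast, inv_inv]
  exact_mod_cast Nat.le_of_dvd n.succ_pos pow_padicValNat_dvd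

/-! ### The exponential and logarithm on the disc of radius `r` -/

/-- Geometric bound for the terms of a power series whose coefficients are dominated by those of
the exponential series. -/
lemma norm_series_term_le {c : ℕ → ℂ_[p]} (hc : ∀ n, ‖c n‖ * expRadius p ^ n ≤ 1) (z : ℂ_[p])
    (n : ℕ) : ‖c n * z ^ (n + 1)‖ ≤ ‖z‖ * (‖z‖ / expRadius p) ^ n := by
  have hr := pow_pos (expRadius_pos p) n
  rw [norm_mul, norm_pow, div_pow, pow_succ, mul_div_assoc', le_div_iff₀ hr]
  calc ‖c n‖ * (‖z‖ ^ n * ‖z‖) * expRadius p ^ n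
      = (‖c n‖ * expRadius p ^ n) * (‖z‖ * ‖z‖ ^ n) := by ring
    _ ≤ 1 * (‖z‖ * ‖z‖ ^ n) := by gcongr; exact hc n
    _ = _ := one_mul _

lemma summable_series {c : ℕ → ℂ_[p]} (hc : ∀ n, ‖c n‖ * expRadius p ^ n ≤ 1) {z : ℂ_[p]}
    (hz : ‖z‖ < expRadius p) : Summable fun n => c n * z ^ (n + 1) := by
  refine Summable.of_norm_bounded (Summable.mul_left _ (summable_geometric_of_lt_one ?_ ?_))
    (norm_series_term_le hc z)
  · exact div_nonneg (norm_nonneg _) (expRadius_pos p).le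
  · exact (div_lt_one (expRadius_pos p)).mpr hz

/-- The linear term strictly dominates all the others, so it alone decides the ultrametric norm.
Both `exp - 1` and `log` are thus isometric near their centres. -/
lemma norm_tsum_series {c : ℕ → ℂ_[p]} (h0 : c 0 = 1) (hc : ∀ n, ‖c n‖ * expRadius p ^ n ≤ 1)
    {z : ℂ_[p]} (hz : ‖z‖ < expRadius p) : ‖∑' n, c n * z ^ (n + 1)‖ = ‖z‖ := by
  rcases eq_or_ne z 0 with rfl | hz0
  · simp
  have hzp : 0 < ‖z‖ := norm_pos_iff.mpr hz0
  have hρ : ‖z‖ / expRadius p < 1 := (div_lt_one (expRadius_pos p)).mpr hz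
  have hρ0 : 0 ≤ ‖z‖ / expRadius p := div_nonneg (norm_nonneg _) (expRadius_pos p).le
  have htail : ‖∑' n, c (n + 1) * z ^ (n + 1 + 1)‖ < ‖z‖ := by
    refine lt_of_le_of_lt (b := ‖z‖ * (‖z‖ / expRadius p))
      (IsUltrametricDist.norm_tsum_le_of_forall_le fun n => ?_) (mul_lt_of_lt_one_right hzp hρ)
    refine (norm_series_term_le hc z (n + 1)).trans ?_
    gcongr
    exact pow_le_of_le_one hρ0 hρ.le n.succ_ne_zero
  rw [(summable_series hc hz).tsum_eq_zero_add]
  simp only [h0, zero_add, pow_one, one_mul]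
  rw [IsUltrametricDist.norm_add_eq_max_of_norm_ne_norm htail.ne', max_eq_left htail.le]

lemma expCoeff_bound (n : ℕ) :
    ‖(((n + 1).factorial : ℂ_[p]))⁻¹‖ * expRadius p ^ n ≤ 1 := by
  have h : 0 < ‖((n + 1).factorial : ℂ_[p])‖ :=
    norm_pos_iff.mpr (mod_cast (n + 1).factorial_ne_zero)
  rw [norm_inv, inv_mul_le_iff₀ h, mul_one]
  exact expRadius_pow_le_norm_factorial n

lemma logCoeff_bound (n : ℕ) :
    ‖(-1) ^ n / ((n + 1 : ℕ) : ℂ_[p])‖ * expRadius p ^ n ≤ 1 := by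
  have h : 0 < ‖((n + 1 : ℕ) : ℂ_[p])‖ := norm_pos_iff.mpr (mod_cast n.succ_ne_zero)
  rw [norm_div, norm_pow, norm_neg, norm_one, one_pow, one_div, inv_mul_le_iff₀ h, mul_one]
  exact (expRadius_pow_le_norm_factorial n).trans (norm_factorial_le n)

lemma exp_sub_one_eq_tsum {y : ℂ_[p]} (hy : ‖y‖ < expRadius p) :
    NormedSpace.exp y - 1 = ∑' n : ℕ, ((n + 1).factorial : ℂ_[p])⁻¹ * y ^ (n + 1) := by
  have hs : Summable fun n : ℕ => y ^ n / (n.factorial : ℂ_[p]) := by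
    rw [← summable_nat_add_iff 1]
    refine (summable_series expCoeff_bound hy).congr fun n => ?_
    rw [div_eq_inv_mul]
  rw [NormedSpace.exp_eq_tsum_div]
  beta_reduce
  rw [hs.tsum_eq_zero_add]
  simp [div_eq_inv_mul]

lemma norm_exp_sub_one {y : ℂ_[p]} (hy : ‖y‖ < expRadius p) :
    ‖NormedSpace.exp y - 1‖ = ‖y‖ := by
  rw [exp_sub_one_eq_tsum hy]
  exact norm_tsum_series (by simp) expCoeff_bound hy

lemma plog_eq_tsum (u : ℂ_[p]) :
    plog u = ∑' n : ℕ, (-1) ^ n / ((n + 1 : ℕ) : ℂ_[p]) * (u - 1) ^ (n + 1) := by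
  rw [plog]
  exact tsum_congr fun n => by ring

lemma norm_plog {u : ℂ_[p]} (hu : ‖u - 1‖ < expRadius p) : ‖plog u‖ = ‖u - 1‖ := by
  rw [plog_eq_tsum]
  exact norm_tsum_series (by simp) logCoeff_bound hu

lemma norm_expSeries_mul_pow_le (n : ℕ) :
    ‖NormedSpace.expSeries ℂ_[p] ℂ_[p] n‖ * expRadius p ^ n ≤ 1 := by
  have h1 : ‖NormedSpace.expSeries ℂ_[p] ℂ_[p] n‖ ≤ ‖((n.factorial : ℂ_[p]))⁻¹‖ := by
    rw [NormedSpace.expSeries]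
    rw [norm_smul, ContinuousMultilinearMap.norm_mkPiAlgebraFin, mul_one]
  refine (mul_le_mul_of_nonneg_right h1 (pow_nonneg (expRadius_pos p).le n)).trans ?_
  rcases n with _ | n
  · simp
  · refine le_trans ?_ (expCoeff_bound (p := p) n)
    gcongr ?_ * ?_
    exact pow_le_pow_of_le_one (expRadius_pos p).le (expRadius_lt_one p).le n.le_succ

lemma expRadius_le_radius :
    ENNReal.ofReal (expRadius p) ≤ (NormedSpace.expSeries ℂ_[p] ℂ_[p]).radius := by
  refine FormalMultilinearSeries.le_radius_of_bound _ 1 (r := (expRadius p).toNNReal) fun n => ?_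
  rw [Real.coe_toNNReal _ (expRadius_pos p).le]
  exact norm_expSeries_mul_pow_le n

lemma radius_expSeries_pos : 0 < (NormedSpace.expSeries ℂ_[p] ℂ_[p]).radius :=
  (ENNReal.ofReal_pos.mpr (expRadius_pos p)).trans_le expRadius_le_radius

lemma mem_eball_radius {y : ℂ_[p]} (hy : ‖y‖ < expRadius p) :
    y ∈ Metric.eball (0 : ℂ_[p]) (NormedSpace.expSeries ℂ_[p] ℂ_[p]).radius := by
  refine Metric.eball_subset_eball expRadius_le_radius ?_
  rw [Metric.eball_ofReal]
  simpa using hy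

lemma norm_natCast_mul_lt {y : ℂ_[p]} {ρ : ℝ} (hy : ‖y‖ < ρ) (n : ℕ) :
    ‖(n : ℂ_[p]) * y‖ < ρ := by
  rw [norm_mul]
  exact (mul_le_of_le_one_left (norm_nonneg _) (norm_natCast_le_one n)).trans_lt hy

lemma exp_natCast_mul {y : ℂ_[p]} (hy : ‖y‖ < expRadius p) (n : ℕ) :
    NormedSpace.exp ((n : ℂ_[p]) * y) = NormedSpace.exp y ^ n := by
  induction n with
  | zero => simp [NormedSpace.exp_zero]
  | succ n ih =>
    rw [Nat.cast_succ, add_mul, one_mul, NormedSpace.exp_add_of_mem_ball (𝕂 := ℂ_[p])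
      (mem_eball_radius (norm_natCast_mul_lt hy n)) (mem_eball_radius hy), ih, pow_succ]

lemma tendsto_prime_pow : Tendsto (fun n : ℕ => (p : ℂ_[p]) ^ n) atTop (𝓝 0) := by
  refine tendsto_pow_atTop_nhds_zero_of_norm_lt_one ?_
  rw [norm_cast_prime]
  exact inv_lt_one_of_one_lt₀ (one_lt_cast_prime p)

lemma cast_prime_pow_ne_zero (n : ℕ) : (p : ℂ_[p]) ^ n ≠ 0 :=
  pow_ne_zero _ (mod_cast (Fact.out : p.Prime).ne_zero)

lemma prime_pow_sub_one_add_one (n : ℕ) : p ^ n - 1 + 1 = p ^ n :=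
  Nat.sub_add_cancel (Nat.pos_of_ne_zero (pow_ne_zero _ (Fact.out : p.Prime).ne_zero))

/-- `(p ^ n - 1 choose k) → (-1) ^ k` in the `p`-adic topology. -/
lemma tendsto_choose_prime_pow_sub_one (k : ℕ) :
    Tendsto (fun n : ℕ => ((p ^ n - 1).choose k : ℂ_[p])) atTop (𝓝 ((-1) ^ k)) := by
  induction k with
  | zero => simp
  | succ k ih =>
    have h : ∀ n : ℕ, ((p ^ n - 1).choose (k + 1) : ℂ_[p]) =
        (p : ℂ_[p]) ^ n * ((p ^ n - 1).choose k / ((k + 1 : ℕ) : ℂ_[p]))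
          - (p ^ n - 1).choose k := by
      intro n
      have hk : ((k + 1 : ℕ) : ℂ_[p]) ≠ 0 := mod_cast k.succ_ne_zero
      -- Pascal's rule combined with `N (N-1 choose k) = (k+1) (N choose k+1)` for `N = p^n`.
      have h1 : ((p ^ n : ℕ) : ℂ_[p]) * (p ^ n - 1).choose k
          = ((p ^ n - 1).choose k + (p ^ n - 1).choose (k + 1)) * (k + 1 : ℕ) := by
        have := Nat.add_one_mul_choose_eq (p ^ n - 1) k
        rw [Nat.choose_succ_succ, prime_pow_sub_one_add_one] at this
        exact_mod_cast this
      rw [Nat.cast_pow] at h1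
      rw [mul_div_assoc', h1]
      field_simp
      ring
    simp only [h]
    have := ((tendsto_prime_pow (p := p)).mul (ih.div_const ((k + 1 : ℕ) : ℂ_[p]))).sub ih
    simpa [pow_succ] using this

/-- A finite binomial expansion, written as an infinite series so that `M = p^n - 1` can go to the
limit termwise against the logarithm series. -/
lemma pow_sub_one_div_eq_tsum (u : ℂ_[p]) (M : ℕ) :
    (u ^ (M + 1) - 1) / ((M + 1 : ℕ) : ℂ_[p]) =
      ∑' k : ℕ, (M.choose k : ℂ_[p]) / ((k + 1 : ℕ) : ℂ_[p]) * (u - 1) ^ (k + 1) := by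
  have hM : ((M + 1 : ℕ) : ℂ_[p]) ≠ 0 := mod_cast M.succ_ne_zero
  rw [tsum_eq_sum (s := Finset.range (M + 1)), div_eq_iff hM, Finset.sum_mul]
  · nth_rewrite 1 [show u = (u - 1) + 1 by ring]
    rw [add_pow, Finset.sum_range_succ']
    simp only [one_pow, mul_one, pow_zero, Nat.choose_zero_right, Nat.cast_one, add_sub_cancel_right]
    refine Finset.sum_congr rfl fun k _ => ?_
    have hk : ((k + 1 : ℕ) : ℂ_[p]) ≠ 0 := mod_cast k.succ_ne_zero
    have h1 : ((M + 1 : ℕ) : ℂ_[p]) * M.choose k = (M + 1).choose (k + 1) * (k + 1 : ℕ) := by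
      exact_mod_cast Nat.add_one_mul_choose_eq M k
    have h2 : ((M + 1).choose (k + 1) : ℂ_[p])
        = ((M + 1 : ℕ) : ℂ_[p]) * M.choose k / (k + 1 : ℕ) := by
      rw [h1, mul_div_cancel_right₀ _ hk]
    rw [h2]
    ring
  · intro k hk
    rw [Nat.choose_eq_zero_of_lt (by simpa using hk)]
    simp

/-- `log u = lim (u ^ (p ^ n) - 1) / p ^ n`. -/
lemma tendsto_plog {u : ℂ_[p]} (hu : ‖u - 1‖ < expRadius p) :
    Tendsto (fun n : ℕ => (u ^ p ^ n - 1) / (p : ℂ_[p]) ^ n) atTop (𝓝 (plog u)) := by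
  have h : ∀ n : ℕ, (u ^ p ^ n - 1) / (p : ℂ_[p]) ^ n =
      ∑' k : ℕ, ((p ^ n - 1).choose k : ℂ_[p]) / ((k + 1 : ℕ) : ℂ_[p]) * (u - 1) ^ (k + 1) := by
    intro n
    rw [← pow_sub_one_div_eq_tsum, prime_pow_sub_one_add_one, Nat.cast_pow]
  simp only [h, plog_eq_tsum]
  refine tendsto_tsum_of_dominated_convergence
    (bound := fun k => ‖u - 1‖ * (‖u - 1‖ / expRadius p) ^ k) ?_ ?_ ?_
  · exact Summable.mul_left _ (summable_geometric_of_lt_one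
      (div_nonneg (norm_nonneg _) (expRadius_pos p).le) ((div_lt_one (expRadius_pos p)).mpr hu))
  · intro k
    exact ((tendsto_choose_prime_pow_sub_one k).div_const _).mul_const _
  · refine Eventually.of_forall fun n k => ?_
    refine norm_series_term_le
      (c := fun k => ((p ^ n - 1).choose k : ℂ_[p]) / ((k + 1 : ℕ) : ℂ_[p])) (fun k => ?_) _ k
    refine le_trans ?_ (logCoeff_bound (p := p) k)
    have := (expRadius_pos p).le
    rw [norm_div, norm_div, norm_pow, norm_neg, norm_one, one_pow]
    gcongr
    exact norm_natCast_le_one _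

lemma hasDerivAt_exp_mul_zero (y : ℂ_[p]) :
    HasDerivAt (fun x : ℂ_[p] => NormedSpace.exp (x * y)) y 0 := by
  have h1 : HasDerivAt (fun x : ℂ_[p] => x * y) y 0 := by
    simpa using (hasDerivAt_id (0 : ℂ_[p])).mul_const y
  have h2 := hasDerivAt_exp_zero_of_radius_pos (radius_expSeries_pos (p := p))
  have h3 := HasDerivAt.comp_of_eq (0 : ℂ_[p]) h2 h1 (by simp)
  rw [one_mul] at h3
  exact h3

/-- As `(exp y)^(p^n) = exp (p^n y)`, the limit formula for the logarithm computes the derivative of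
`x ↦ exp (x y)` at `0` along `x = p^n`. -/
lemma plog_exp {y : ℂ_[p]} (hy : ‖y‖ < expRadius p) : plog (NormedSpace.exp y) = y := by
  have h1 := tendsto_plog (u := NormedSpace.exp y) (by rwa [norm_exp_sub_one hy])
  refine tendsto_nhds_unique h1 ?_
  have h2 := hasDerivAt_iff_tendsto_slope_zero.mp (hasDerivAt_exp_mul_zero y)
  have h3 : Tendsto (fun n : ℕ => (p : ℂ_[p]) ^ n) atTop (𝓝[≠] 0) :=
    tendsto_nhdsWithin_iff.mpr ⟨tendsto_prime_pow, Eventually.of_forall cast_prime_pow_ne_zero⟩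
  refine (h2.comp h3).congr fun n => ?_
  have := exp_natCast_mul hy (p ^ n)
  rw [Nat.cast_pow] at this
  simp [NormedSpace.exp_zero, this, div_eq_inv_mul]

lemma norm_pow_sub_one_le {u : ℂ_[p]} (hu : ‖u - 1‖ < 1) (n : ℕ) : ‖u ^ n - 1‖ ≤ ‖u - 1‖ := by
  have hu1 : ‖u‖ ≤ 1 := by
    have := IsUltrametricDist.norm_add_le_max (u - 1) 1
    rw [sub_add_cancel, norm_one] at this
    exact this.trans (max_le hu.le le_rfl)
  rw [← mul_geom_sum, norm_mul]
  refine mul_le_of_le_one_right (norm_nonneg _) ?_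
  refine IsUltrametricDist.norm_sum_le_of_forall_le_of_nonneg zero_le_one fun i _ => ?_
  rw [norm_pow]
  exact pow_le_one₀ (norm_nonneg _) hu1

/-- The quotient of `u^(i p^n) - 1` by `u^(p^n) - 1` is a geometric sum of `i` terms, each tending
to `1`. -/
lemma plog_pow {u : ℂ_[p]} (hu : ‖u - 1‖ < expRadius p) (i : ℕ) :
    plog (u ^ i) = i * plog u := by
  have hu1 := hu.trans (expRadius_lt_one p)
  have h1 := tendsto_plog ((norm_pow_sub_one_le hu1 i).trans_lt hu)
  refine tendsto_nhds_unique h1 ?_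
  have h2 := tendsto_plog hu
  have h3 : Tendsto (fun n : ℕ => u ^ p ^ n) atTop (𝓝 1) := by
    have := (h2.mul (tendsto_prime_pow (p := p))).add_const 1
    rw [mul_zero, zero_add] at this
    refine this.congr fun n => ?_
    rw [div_mul_cancel₀ _ (cast_prime_pow_ne_zero n), sub_add_cancel]
  have h4 : Tendsto (fun n : ℕ => ∑ j ∈ Finset.range i, (u ^ p ^ n) ^ j) atTop
      (𝓝 (∑ j ∈ Finset.range i, 1 ^ j)) := tendsto_finsetSum _ fun j _ => h3.pow j
  have h5 := h4.mul h2
  simp only [one_pow, Finset.sum_const, Finset.card_range, nsmul_eq_mul, mul_one] at h5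
  refine h5.congr fun n => ?_
  rw [mul_div_assoc', geom_sum_mul, pow_right_comm]

lemma norm_pow_sub_one {u : ℂ_[p]} (hu : ‖u - 1‖ < expRadius p) (i : ℕ) :
    ‖u ^ i - 1‖ = ‖(i : ℂ_[p])‖ * ‖u - 1‖ := by
  have hu1 := hu.trans (expRadius_lt_one p)
  rw [← norm_plog hu, ← norm_plog ((norm_pow_sub_one_le hu1 i).trans_lt hu), plog_pow hu, norm_mul]

/-! ### The `q`-Bernoulli numbers as moments -/

open Polynomial in
/-- The linear functional on polynomials with `X ^ i ↦ i (q - 1) / (q ^ i - 1)` for `i ≥ 1` and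
`1 ↦ β_{0,q}`; up to the factor `β_{0,q}` it is the Volkenborn integral of `P (q ^ x)`. -/
def momentFunctional (q : ℂ_[p]) : ℂ_[p][X] →ₗ[ℂ_[p]] ℂ_[p] :=
  Polynomial.lsum fun i => (if i = 0 then qBernoulli q 0 else i * (q - 1) / (q ^ i - 1)) •
    LinearMap.id

open Polynomial in
lemma momentFunctional_monomial (q a : ℂ_[p]) (i : ℕ) :
    momentFunctional q (monomial i a) =
      (if i = 0 then qBernoulli q 0 else i * (q - 1) / (q ^ i - 1)) * a := by
  rw [momentFunctional, Polynomial.lsum_apply, Polynomial.sum_monomial_index]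
  · rfl
  · exact map_zero _

open Polynomial in
-- Counterpart of the Volkenborn rule `∫ f(x+1) - ∫ f(x) = f'(0)` for `f(x) = P(q^x)`: the
-- substitution `X ↦ q X` is the shift of `x` by one.
lemma momentFunctional_comp_sub {q : ℂ_[p]} (hq : ∀ i : ℕ, i ≠ 0 → q ^ i - 1 ≠ 0)
    (P : ℂ_[p][X]) :
    momentFunctional q (P.comp (C q * X)) - momentFunctional q P =
      (q - 1) * P.derivative.eval 1 := by
  induction P using Polynomial.induction_on' with
  | add P R hP hR =>
    rw [add_comp, map_add, map_add, derivative_add, eval_add, mul_add, ← hP, ← hR]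
    ring
  | monomial i a =>
    have h : (monomial i a).comp (C q * X) = monomial i (a * q ^ i) := by
      rw [monomial_comp, mul_pow, ← C_pow, ← mul_assoc, ← C_mul, C_mul_X_pow_eq_monomial]
    rw [h, momentFunctional_monomial, momentFunctional_monomial, derivative_monomial,
      eval_monomial, one_pow, mul_one]
    rcases eq_or_ne i 0 with rfl | hi
    · simp
    · have := hq i hi
      rw [if_neg hi]
      field_simp

open Polynomial in
/-- The polynomial `(1 - X) / (1 - q)`, whose value at `q ^ x` is `[x]_q`. -/
def qNumPoly (q : ℂ_[p]) : ℂ_[p][X] := C (1 - q)⁻¹ * (1 - X)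

open Polynomial in
-- The shift turns `[x]_q` into `q [x]_q + 1`; expanding its `n`-th power makes the shift rule the
-- defining recursion.
lemma qBernoulli_eq_momentFunctional {q : ℂ_[p]} (hq : ∀ i : ℕ, i ≠ 0 → q ^ i - 1 ≠ 0) (n : ℕ) :
    qBernoulli q n = momentFunctional q (qNumPoly q ^ n) := by
  have hq1 : 1 - q ≠ 0 := by
    have := hq 1 one_ne_zero
    rw [pow_one] at this
    exact sub_ne_zero.mpr (sub_ne_zero.mp this).symm
  induction n using Nat.strong_induction_on with
  | _ n ih =>
  rcases n with _ | n
  · have := momentFunctional_monomial q 1 0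
    rw [pow_zero, ← monomial_zero_one, this]
    simp
  have hcomp : (qNumPoly q).comp (C q * X) = C q * qNumPoly q + 1 := by
    have h1 : (C (1 - q)⁻¹ : ℂ_[p][X]) * (1 - C q) = 1 := by
      rw [← C_1, ← C_sub, ← C_mul, inv_mul_cancel₀ hq1]
    have h2 : (qNumPoly q).comp (C q * X) = C (1 - q)⁻¹ * (1 - C q * X) := by
      simp [qNumPoly]
    rw [h2, qNumPoly]
    linear_combination (-1 : ℂ_[p][X]) * h1 + 2 * h1
  have hexp : momentFunctional q ((qNumPoly q ^ (n + 1)).comp (C q * X)) =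
      ∑ i ∈ Finset.range (n + 1 + 1), ((n + 1).choose i : ℂ_[p]) * q ^ i *
        momentFunctional q (qNumPoly q ^ i) := by
    rw [pow_comp, hcomp, add_pow, map_sum]
    refine Finset.sum_congr rfl fun i _ => ?_
    have hi : (C q * qNumPoly q) ^ i * 1 ^ (n + 1 - i) * ((n + 1).choose i : ℂ_[p][X]) =
        (((n + 1).choose i : ℂ_[p]) * q ^ i) • qNumPoly q ^ i := by
      rw [smul_eq_C_mul, C_mul, C_pow, C_eq_natCast]
      ring
    rw [hi, map_smul, smul_eq_mul]
  -- The polynomial vanishes at `1`, so its powers beyond the first have zero derivative there.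
  have hder : (q - 1) * (qNumPoly q ^ (n + 1)).derivative.eval 1 = if n + 1 = 1 then 1 else 0 := by
    rw [derivative_pow]
    rcases eq_or_ne n 0 with rfl | hn
    · simp [qNumPoly]
      field_simp
      ring
    · simp [qNumPoly, hn]
  have h := momentFunctional_comp_sub hq (qNumPoly q ^ (n + 1))
  rw [hexp, hder, Finset.sum_range_succ, Nat.choose_self, Nat.cast_one, one_mul] at h
  have hsum : ∑ i ∈ Finset.range (n + 1), ((n + 1).choose i : ℂ_[p]) * q ^ i * qBernoulli q i =
      ∑ i ∈ Finset.range (n + 1),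
        ((n + 1).choose i : ℂ_[p]) * q ^ i * momentFunctional q (qNumPoly q ^ i) :=
    Finset.sum_congr rfl fun i hi => by rw [ih i (Finset.mem_range.mp hi)]
  rw [qBernoulli, div_eq_iff (hq _ n.succ_ne_zero), ← h,
    Fin.sum_univ_eq_sum_range (fun i => ((n + 1).choose i : ℂ_[p]) * q ^ i * qBernoulli q i), hsum,
    Nat.succ_eq_add_one]
  ring

/-! ### Mahler coefficients and growth of the `q`-Bernoulli numbers -/

/-- The `k`-th Mahler coefficient of the function `x ↦ [x]_q ^ n`. -/
def qPowMahler (q : ℂ_[p]) (n k : ℕ) : ℂ_[p] :=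
  ∑ i ∈ Finset.range (n + 1), (1 - q)⁻¹ ^ n * (-1) ^ i * n.choose i * (q ^ i - 1) ^ k

lemma sum_eq_one_sub_pow (y : ℂ_[p]) (n : ℕ) :
    ∑ i ∈ Finset.range (n + 1), (-1) ^ i * (n.choose i : ℂ_[p]) * y ^ i = (1 - y) ^ n := by
  rw [sub_eq_neg_add, add_pow]
  refine Finset.sum_congr rfl fun i _ => ?_
  rw [neg_pow, one_pow]
  ring

/-- The `k`-th finite difference at `0` of `j ↦ [j]_q^n`. This form shows integrality, the defining
one decay in `k`. -/
lemma qPowMahler_eq (q : ℂ_[p]) (n k : ℕ) :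
    qPowMahler q n k = ∑ j ∈ Finset.range (k + 1),
      (-1) ^ (k - j) * (k.choose j : ℂ_[p]) * ((1 - q ^ j) / (1 - q)) ^ n := by
  have h : ∀ j : ℕ, ((1 - q ^ j) / (1 - q)) ^ n = ∑ i ∈ Finset.range (n + 1),
      (1 - q)⁻¹ ^ n * ((-1) ^ i * (n.choose i : ℂ_[p]) * (q ^ j) ^ i) := by
    intro j
    rw [← Finset.mul_sum, sum_eq_one_sub_pow, div_eq_inv_mul, mul_pow]
  simp only [h, Finset.mul_sum, qPowMahler]
  rw [Finset.sum_comm]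
  refine Finset.sum_congr rfl fun i _ => ?_
  rw [sub_eq_add_neg (q ^ i), add_pow, Finset.mul_sum]
  refine Finset.sum_congr rfl fun j _ => ?_
  rw [pow_right_comm]
  ring

lemma norm_qPowMahler_le_one {q : ℂ_[p]} (hq : ‖q - 1‖ < 1) (n k : ℕ) :
    ‖qPowMahler q n k‖ ≤ 1 := by
  rw [qPowMahler_eq]
  refine IsUltrametricDist.norm_sum_le_of_forall_le_of_nonneg zero_le_one fun j _ => ?_
  rw [norm_mul, norm_mul, norm_pow, norm_neg, norm_one, one_pow, one_mul, norm_pow]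
  refine mul_le_one₀ (norm_natCast_le_one _) (by positivity) (pow_le_one₀ (norm_nonneg _) ?_)
  rw [norm_div, norm_sub_rev, norm_sub_rev 1 q]
  exact div_le_one_of_le₀ (norm_pow_sub_one_le hq j) (norm_nonneg _)

lemma norm_qPowMahler_add_le {q : ℂ_[p]} (hq : ‖q - 1‖ < 1) (hq1 : q ≠ 1) (n k : ℕ) :
    ‖qPowMahler q n (n + k)‖ ≤ ‖q - 1‖ ^ k := by
  refine IsUltrametricDist.norm_sum_le_of_forall_le_of_nonneg (by positivity) fun i _ => ?_
  have h0 : 0 < ‖q - 1‖ := norm_pos_iff.mpr (sub_ne_zero.mpr hq1)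
  rw [norm_mul, norm_mul, norm_mul, norm_pow, norm_pow, norm_pow, norm_neg, norm_one, one_pow,
    mul_one, norm_inv, norm_sub_rev 1 q]
  calc ‖q - 1‖⁻¹ ^ n * ‖(n.choose i : ℂ_[p])‖ * ‖q ^ i - 1‖ ^ (n + k)
      ≤ ‖q - 1‖⁻¹ ^ n * 1 * ‖q - 1‖ ^ (n + k) := by
        gcongr
        · exact norm_natCast_le_one _
        · exact norm_pow_sub_one_le hq i
    _ = ‖q - 1‖ ^ k := by
        rw [pow_add, mul_one, ← mul_assoc, ← mul_pow, inv_mul_cancel₀ h0.ne', one_pow, one_mul]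

lemma pow_sub_one_ne_zero {q : ℂ_[p]} (hq : ‖q - 1‖ < expRadius p) (hq1 : q ≠ 1) (i : ℕ)
    (hi : i ≠ 0) : q ^ i - 1 ≠ 0 := by
  rw [← norm_ne_zero_iff, norm_pow_sub_one hq]
  exact mul_ne_zero (norm_ne_zero_iff.mpr (mod_cast hi))
    (norm_ne_zero_iff.mpr (sub_ne_zero.mpr hq1))

lemma plog_ne_zero {q : ℂ_[p]} (hq : ‖q - 1‖ < expRadius p) (hq1 : q ≠ 1) : plog q ≠ 0 := by
  rw [← norm_ne_zero_iff, norm_plog hq]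
  exact norm_ne_zero_iff.mpr (sub_ne_zero.mpr hq1)

/-- The series is `log(q^i) / (q^i - 1)` scaled by `β_{0,q}`, and `log(q^i) = i log q`. For `i = 0`
only `k = 0` survives. -/
lemma hasSum_moment {q : ℂ_[p]} (hq : ‖q - 1‖ < expRadius p) (hq1 : q ≠ 1) (i : ℕ) :
    HasSum (fun k : ℕ => qBernoulli q 0 * ((-1) ^ k / ((k + 1 : ℕ) : ℂ_[p])) * (q ^ i - 1) ^ k)
      (if i = 0 then qBernoulli q 0 else i * (q - 1) / (q ^ i - 1)) := by
  rcases eq_or_ne i 0 with rfl | hi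
  · have := hasSum_single (f := fun k : ℕ => qBernoulli q 0 *
      ((-1) ^ k / ((k + 1 : ℕ) : ℂ_[p])) * (q ^ 0 - 1) ^ k) 0 (fun k hk => by simp [hk])
    simpa using this
  · have h0 := pow_sub_one_ne_zero hq hq1 i hi
    have hi1 : ‖q ^ i - 1‖ < expRadius p :=
      (norm_pow_sub_one_le (hq.trans (expRadius_lt_one p)) i).trans_lt hq
    have h := (summable_series logCoeff_bound hi1).hasSum
    rw [← plog_eq_tsum, plog_pow hq] at h
    have h2 := h.mul_left (qBernoulli q 0 * (q ^ i - 1)⁻¹)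
    have hl := plog_ne_zero hq hq1
    rw [if_neg hi]
    convert! h2 using 1
    · funext k
      rw [pow_succ]
      field_simp
    · rw [qBernoulli]
      field_simp

open Polynomial in
lemma hasSum_qBernoulli {q : ℂ_[p]} (hq : ‖q - 1‖ < expRadius p) (hq1 : q ≠ 1) (n : ℕ) :
    HasSum (fun k : ℕ => qBernoulli q 0 * ((-1) ^ k / ((k + 1 : ℕ) : ℂ_[p])) * qPowMahler q n k)
      (qBernoulli q n) := by
  have hpoly : qNumPoly q ^ n = ∑ i ∈ Finset.range (n + 1),
      monomial i ((1 - q)⁻¹ ^ n * (-1) ^ i * (n.choose i : ℂ_[p])) := by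
    rw [qNumPoly, mul_pow, sub_eq_neg_add 1 X, add_pow, Finset.mul_sum]
    refine Finset.sum_congr rfl fun i _ => ?_
    rw [← C_mul_X_pow_eq_monomial, neg_pow, one_pow]
    simp only [map_mul, map_pow, map_neg, map_one, map_natCast]
    ring
  rw [qBernoulli_eq_momentFunctional (pow_sub_one_ne_zero hq hq1) n, hpoly, map_sum]
  simp only [momentFunctional_monomial]
  have h := hasSum_sum (s := Finset.range (n + 1)) fun i _ =>
    (hasSum_moment hq hq1 i).mul_right ((1 - q)⁻¹ ^ n * (-1) ^ i * (n.choose i : ℂ_[p]))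
  convert! h using 2 with k
  rw [qPowMahler, Finset.mul_sum]
  exact Finset.sum_congr rfl fun i _ => by ring

lemma norm_qBernoulli_zero {q : ℂ_[p]} (hq : ‖q - 1‖ < expRadius p) (hq1 : q ≠ 1) :
    ‖qBernoulli q 0‖ = 1 := by
  rw [qBernoulli, norm_div, norm_plog hq, div_self]
  exact norm_ne_zero_iff.mpr (sub_ne_zero.mpr hq1)

/-- The factor `1/(k+1)` costs at most `k + 1`. For `k ≤ n` integrality suffices; for `k = n + j`
the decay `2^(-j)` absorbs the excess, since `n + j + 1 ≤ (n+1)(j+1) ≤ (n+1) 2^j`. -/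
lemma norm_qBernoulli_le {q : ℂ_[p]} (hq : ‖q - 1‖ < expRadius p) (hq2 : ‖q - 1‖ ≤ 1 / 2)
    (hq1 : q ≠ 1) (n : ℕ) : ‖qBernoulli q n‖ ≤ n + 1 := by
  rw [← (hasSum_qBernoulli hq hq1 n).tsum_eq]
  refine IsUltrametricDist.norm_tsum_le_of_forall_le fun k => ?_
  have hlt := hq.trans (expRadius_lt_one p)
  have hk := inv_norm_natCast_le (p := p) k
  rw [norm_mul, norm_mul, norm_qBernoulli_zero hq hq1, one_mul, norm_div, norm_pow, norm_neg,
    norm_one, one_pow, one_div, ← norm_inv]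
  rcases le_total k n with hkn | hkn
  · have : (k : ℝ) ≤ n := mod_cast hkn
    calc _ ≤ ((k : ℝ) + 1) * 1 := by
          gcongr
          exact norm_qPowMahler_le_one hlt n k
      _ ≤ n + 1 := by linarith
  · obtain ⟨j, rfl⟩ := Nat.exists_eq_add_of_le hkn
    have hj : ((j : ℝ) + 1) ≤ 2 ^ j := by exact_mod_cast Nat.lt_two_pow_self
    calc _ ≤ (((n + j : ℕ) : ℝ) + 1) * (1 / 2) ^ j := by
          gcongr
          exact (norm_qPowMahler_add_le hlt hq1 n j).trans (by gcongr)
      _ ≤ (((n : ℝ) + 1) * 2 ^ j) * (1 / 2) ^ j := by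
          gcongr
          push_cast
          nlinarith [mul_nonneg n.cast_nonneg (α := ℝ) (j.cast_nonneg (α := ℝ)),
            n.cast_nonneg (α := ℝ)]
      _ = n + 1 := by
          rw [mul_assoc, ← mul_pow]
          norm_num

/-! ### Norms of `p^*`, of `a + p^* t` and of `q`-numbers -/

lemma norm_pStar_le_inv : ‖(pStar p : ℂ_[p])‖ ≤ (p : ℝ)⁻¹ := by
  rw [pStar]
  split_ifs with h
  · subst h
    rw [show ((4 : ℕ) : ℂ_[2]) = ((2 : ℕ) : ℂ_[2]) * ((2 : ℕ) : ℂ_[2]) by norm_num, norm_mul,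
      norm_cast_prime]
    norm_num
  · exact norm_cast_prime.le

/-- For odd `p`, `1/p = r^(p-1) < r`. For `p = 2` the radius is `1/2` itself, hence the choice `2^*
= 4`. -/
lemma norm_pStar_lt_expRadius : ‖(pStar p : ℂ_[p])‖ < expRadius p := by
  have h0 := expRadius_pos p
  have h1 := expRadius_lt_one p
  have h2 := expRadius_pow p
  rw [pStar]
  split_ifs with h
  · subst h
    rw [show ((4 : ℕ) : ℂ_[2]) = ((2 : ℕ) : ℂ_[2]) * ((2 : ℕ) : ℂ_[2]) by norm_num, norm_mul,
      norm_cast_prime, ← h2, Nat.add_one_sub_one, pow_one]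
    exact mul_lt_of_lt_one_right h0 h1
  · rw [norm_cast_prime, ← h2]
    have := (Fact.out : p.Prime).two_le
    exact pow_lt_self_of_lt_one₀ h0 h1 (by omega)

lemma norm_pStar_lt_one : ‖(pStar p : ℂ_[p])‖ < 1 :=
  norm_pStar_lt_expRadius.trans (expRadius_lt_one p)

lemma norm_natCast_le_of_dvd {m n : ℕ} (h : m ∣ n) : ‖(n : ℂ_[p])‖ ≤ ‖(m : ℂ_[p])‖ := by
  obtain ⟨k, rfl⟩ := h
  rw [Nat.cast_mul, norm_mul]
  exact mul_le_of_le_one_right (norm_nonneg _) (norm_natCast_le_one k)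

lemma norm_pt {a : ℕ} (ha : a.Coprime p) {t : ℂ_[p]} (ht : ‖t‖ ≤ 1) : ‖pt a t‖ = 1 := by
  have h1 := norm_natCast_eq_one_of_coprime ha
  have h2 : ‖(pStar p : ℂ_[p]) * t‖ < 1 := by
    rw [norm_mul]
    exact (mul_le_of_le_one_right (norm_nonneg _) ht).trans_lt norm_pStar_lt_one
  rw [pt, IsUltrametricDist.norm_add_eq_max_of_norm_ne_norm (by rw [h1]; exact h2.ne'), h1,
    max_eq_left h2.le]

section base

variable {q : ℂ_[p]} (hq : ‖q - 1‖ < expRadius p)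
include hq

lemma norm_mul_plog_lt {x : ℂ_[p]} (hx : ‖x‖ ≤ 1) : ‖x * plog q‖ < expRadius p := by
  rw [norm_mul, norm_plog hq]
  exact (mul_le_of_le_one_left (norm_nonneg _) hx).trans_lt hq

lemma norm_ppow_sub_one {x : ℂ_[p]} (hx : ‖x‖ ≤ 1) : ‖ppow q x - 1‖ = ‖x‖ * ‖q - 1‖ := by
  rw [ppow, norm_exp_sub_one (norm_mul_plog_lt hq hx), norm_mul, norm_plog hq]

lemma norm_ppow_le_one {x : ℂ_[p]} (hx : ‖x‖ ≤ 1) : ‖ppow q x‖ ≤ 1 := by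
  have h := IsUltrametricDist.norm_add_le_max (ppow q x - 1) 1
  rw [sub_add_cancel, norm_one, norm_ppow_sub_one hq hx] at h
  refine h.trans (max_le ?_ le_rfl)
  exact mul_le_one₀ hx (norm_nonneg _) (hq.trans (expRadius_lt_one p)).le

lemma norm_qNum (hq1 : q ≠ 1) {x : ℂ_[p]} (hx : ‖x‖ ≤ 1) : ‖qNum q x‖ = ‖x‖ := by
  rw [qNum, norm_div, norm_sub_rev, norm_sub_rev 1 q, norm_ppow_sub_one hq hx,
    mul_div_cancel_right₀]
  exact norm_ne_zero_iff.mpr (sub_ne_zero.mpr hq1)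

lemma qNum_ppow (hq1 : q ≠ 1) {x : ℂ_[p]} (hx : ‖x‖ ≤ 1) (hx0 : x ≠ 0) (y : ℂ_[p]) :
    qNum (ppow q x) (y / x) = qNum q y / qNum q x := by
  have h1 : 1 - q ≠ 0 := sub_ne_zero.mpr hq1.symm
  have h2 : ppow (ppow q x) (y / x) = ppow q y := by
    rw [ppow, ppow, plog_exp (norm_mul_plog_lt hq hx), ppow]
    congr 1
    field_simp
  rw [qNum, h2, qNum, qNum, div_div_div_cancel_right₀ h1]

end base

/-! ### Convergence of the series and the slope of each summand at `s = 1` -/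

/-- The factor `β_{m,q^F} q^{x m} ([F]_q / [x]_q)^m` shared by the series under consideration. -/
def seriesCoeff (q : ℂ_[p]) (F : ℕ) (x : ℂ_[p]) (m : ℕ) : ℂ_[p] :=
  qBernoulli (q ^ F) m * ppow q (x * (m : ℂ_[p])) * (qNum q (F : ℂ_[p]) / qNum q x) ^ m

lemma norm_seriesCoeff_le {q : ℂ_[p]} (hq : ‖q - 1‖ < expRadius p) (hq1 : q ≠ 1) {F : ℕ}
    (hF : 0 < F) (hpF : pStar p ∣ F) {x : ℂ_[p]} (hx : ‖x‖ = 1) (m : ℕ) :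
    ‖seriesCoeff q F x m‖ ≤ (m + 1) * ‖(F : ℂ_[p])‖ ^ m := by
  have hF1 := norm_natCast_le_one (p := p) F
  have hQ := norm_pow_sub_one hq F
  have hQ1 : ‖q ^ F - 1‖ < expRadius p := by
    rw [hQ]
    exact (mul_le_of_le_one_left (norm_nonneg _) hF1).trans_lt hq
  have hQ2 : ‖q ^ F - 1‖ ≤ 1 / 2 := by
    rw [hQ]
    calc ‖(F : ℂ_[p])‖ * ‖q - 1‖ ≤ ‖(F : ℂ_[p])‖ :=
          mul_le_of_le_one_right (norm_nonneg _) (hq.trans (expRadius_lt_one p)).le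
      _ ≤ (p : ℝ)⁻¹ := (norm_natCast_le_of_dvd hpF).trans norm_pStar_le_inv
      _ ≤ 1 / 2 := by
          rw [← one_div]
          have : (2 : ℝ) ≤ p := mod_cast (Fact.out : p.Prime).two_le
          gcongr
  have hQ3 : q ^ F ≠ 1 := sub_ne_zero.mp (pow_sub_one_ne_zero hq hq1 F hF.ne')
  rw [seriesCoeff, norm_mul, norm_mul, norm_pow, norm_div, norm_qNum hq hq1 hF1,
    norm_qNum hq hq1 hx.le, hx, div_one]
  have hxm : ‖x * (m : ℂ_[p])‖ ≤ 1 := by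
    rw [norm_mul, hx, one_mul]
    exact norm_natCast_le_one m
  gcongr
  calc _ ≤ ((m : ℝ) + 1) * 1 := by
        gcongr
        · exact norm_qBernoulli_le hQ1 hQ2 hQ3 m
        · exact norm_ppow_le_one hq hxm
    _ = m + 1 := mul_one _

/-- `(x choose m + 1) / x`, as a polynomial function of `x`. -/
def chooseQuot (m : ℕ) (x : ℂ_[p]) : ℂ_[p] :=
  ((m + 1).factorial : ℂ_[p])⁻¹ * ∏ j ∈ Finset.range m, (x - ((j + 1 : ℕ) : ℂ_[p]))

/-- Isolates the factor `1 - s` that cancels the pole. -/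
lemma choose_succ_eq (x : ℂ_[p]) (m : ℕ) : Ring.choose x (m + 1) = x * chooseQuot m x := by
  have h0 : ((m + 1).factorial : ℂ_[p]) ≠ 0 := mod_cast (m + 1).factorial_ne_zero
  have h := Ring.descPochhammer_eq_factorial_smul_choose x (m + 1)
  rw [← Polynomial.aeval_eq_smeval, Polynomial.aeval_def, Polynomial.eval₂_eq_eval_map,
    descPochhammer_map, descPochhammer_eval_eq_prod_range, nsmul_eq_mul,
    Finset.prod_range_succ'] at h
  rw [chooseQuot, mul_left_comm, eq_inv_mul_iff_mul_eq₀ h0, ← h]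
  simp [mul_comm]

lemma chooseQuot_zero (m : ℕ) :
    chooseQuot m (0 : ℂ_[p]) = (-1) ^ m / ((m + 1 : ℕ) : ℂ_[p]) := by
  have h : ∏ j ∈ Finset.range m, ((0 : ℂ_[p]) - ((j + 1 : ℕ) : ℂ_[p])) =
      (-1) ^ m * (m.factorial : ℂ_[p]) := by
    rw [← Finset.prod_range_add_one_eq_factorial, Nat.cast_prod]
    simp only [zero_sub]
    rw [Finset.prod_neg, Finset.card_range]
  have h0 : ((m.factorial : ℕ) : ℂ_[p]) ≠ 0 := mod_cast m.factorial_ne_zero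
  have h1 : ((m + 1 : ℕ) : ℂ_[p]) ≠ 0 := mod_cast m.succ_ne_zero
  rw [chooseQuot, h, Nat.factorial_succ, Nat.cast_mul]
  field_simp

lemma continuous_chooseQuot (m : ℕ) : Continuous (chooseQuot m : ℂ_[p] → ℂ_[p]) := by
  unfold chooseQuot
  fun_prop

lemma norm_chooseQuot_mul_le {x : ℂ_[p]} (hx : ‖x‖ ≤ 1) (m : ℕ) :
    ‖chooseQuot m x‖ * expRadius p ^ m ≤ 1 := by
  refine le_trans ?_ (expCoeff_bound (p := p) m)
  have := (expRadius_pos p).le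
  rw [chooseQuot, norm_mul, norm_prod]
  gcongr
  refine mul_le_of_le_one_right (norm_nonneg _) (Finset.prod_le_one (fun _ _ => norm_nonneg _) ?_)
  intro j _
  rw [sub_eq_add_neg]
  refine (IsUltrametricDist.norm_add_le_max _ _).trans (max_le hx ?_)
  rw [norm_neg]
  exact norm_natCast_le_one _

section terms

variable {q : ℂ_[p]} (hq : ‖q - 1‖ < expRadius p) (hq1 : q ≠ 1) {F : ℕ}
  (hF : 0 < F) (hpF : pStar p ∣ F)
include hq hq1

lemma LTerm_eq {a : ℕ} (ha : a.Coprime p) {t : ℂ_[p]} (ht : ‖t‖ ≤ 1) (s : ℂ_[p]) (m : ℕ) :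
    LTerm q F a s t m = Ring.choose (1 - s) m * seriesCoeff q F (pt a t) m := by
  have hx := norm_pt ha ht
  have hx0 : pt a t ≠ 0 := norm_ne_zero_iff.mp (by rw [hx]; exact one_ne_zero)
  rw [LTerm, seriesCoeff, qNum_ppow hq hq1 hx.le hx0]
  ring

omit hq hq1 in
lemma oneTerm_eq (a : ℕ) (t : ℂ_[p]) (m : ℕ) :
    oneTerm q F a t m = -(chooseQuot m 0 * seriesCoeff q F (pt a t) (m + 1)) := by
  rw [oneTerm, seriesCoeff, chooseQuot_zero, pow_succ]
  ring

include hF hpF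

lemma norm_chooseQuot_mul_seriesCoeff_le {x y : ℂ_[p]} (hx : ‖x‖ = 1) (hy : ‖y‖ ≤ 1) (m : ℕ) :
    ‖chooseQuot m y * seriesCoeff q F x (m + 1)‖ ≤
      ((m : ℝ) + 2) * (‖(F : ℂ_[p])‖ / expRadius p) ^ m := by
  have hr := pow_pos (expRadius_pos p) m
  have h1 := norm_chooseQuot_mul_le hy m
  have h2 := norm_seriesCoeff_le hq hq1 hF hpF hx (m + 1)
  rw [norm_mul, div_pow, mul_div_assoc', le_div_iff₀ hr]
  calc ‖chooseQuot m y‖ * ‖seriesCoeff q F x (m + 1)‖ * expRadius p ^ m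
      = (‖chooseQuot m y‖ * expRadius p ^ m) * ‖seriesCoeff q F x (m + 1)‖ := by ring
    _ ≤ 1 * ((((m + 1 : ℕ) : ℝ) + 1) * ‖(F : ℂ_[p])‖ ^ (m + 1)) := by gcongr
    _ ≤ 1 * ((((m + 1 : ℕ) : ℝ) + 1) * ‖(F : ℂ_[p])‖ ^ m) := by
        gcongr 1 * (_ * ?_)
        exact pow_le_pow_of_le_one (norm_nonneg _) (norm_natCast_le_one F) m.le_succ
    _ = _ := by
        push_cast
        ring

omit hq hq1 hF in
lemma summable_bound :
    Summable fun m : ℕ => ((m : ℝ) + 2) * (‖(F : ℂ_[p])‖ / expRadius p) ^ m := by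
  have h0 : 0 ≤ ‖(F : ℂ_[p])‖ / expRadius p := div_nonneg (norm_nonneg _) (expRadius_pos p).le
  have h1 : ‖(F : ℂ_[p])‖ / expRadius p < 1 := (div_lt_one (expRadius_pos p)).mpr
    ((norm_natCast_le_of_dvd hpF).trans_lt norm_pStar_lt_expRadius)
  have h2 := summable_pow_mul_geometric_of_norm_lt_one 1 (R := ℝ)
    (r := ‖(F : ℂ_[p])‖ / expRadius p) (by rwa [Real.norm_of_nonneg h0])
  refine (h2.add ((summable_geometric_of_lt_one h0 h1).mul_left 2)).congr fun m => ?_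
  ring

lemma summable_chooseQuot_mul {x y : ℂ_[p]} (hx : ‖x‖ = 1) (hy : ‖y‖ ≤ 1) :
    Summable fun m => chooseQuot m y * seriesCoeff q F x (m + 1) :=
  Summable.of_norm_bounded (summable_bound hpF)
    (norm_chooseQuot_mul_seriesCoeff_le hq hq1 hF hpF hx hy)

lemma summable_LTerm {a : ℕ} (ha : a.Coprime p) {t : ℂ_[p]} (ht : ‖t‖ ≤ 1) {s : ℂ_[p]}
    (hs : ‖s - 1‖ ≤ 1) : Summable (LTerm q F a s t) := by
  rw [← summable_nat_add_iff 1]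
  rw [norm_sub_rev] at hs
  refine ((summable_chooseQuot_mul hq hq1 hF hpF (norm_pt ha ht) hs).mul_left (1 - s)).congr
    fun m => ?_
  rw [LTerm_eq hq hq1 ha ht, choose_succ_eq]
  ring

lemma summable_oneTerm {a : ℕ} (ha : a.Coprime p) {t : ℂ_[p]} (ht : ‖t‖ ≤ 1) :
    Summable (oneTerm q F a t) :=
  (summable_chooseQuot_mul hq hq1 hF hpF (norm_pt ha ht) (y := 0) (by simp)).neg.congr
    fun m => (oneTerm_eq a t m).symm

lemma tsum_LTerm_eq {a : ℕ} (ha : a.Coprime p) {t : ℂ_[p]} (ht : ‖t‖ ≤ 1) {s : ℂ_[p]}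
    (hs : ‖s - 1‖ ≤ 1) :
    ∑' m, LTerm q F a s t m = qBernoulli (q ^ F) 0 +
      (1 - s) * ∑' m, chooseQuot m (1 - s) * seriesCoeff q F (pt a t) (m + 1) := by
  rw [(summable_LTerm hq hq1 hF hpF ha ht hs).tsum_eq_zero_add, ← tsum_mul_left]
  congr 1
  · simp [LTerm, ppow, NormedSpace.exp_zero]
  · refine tsum_congr fun m => ?_
    rw [LTerm_eq hq hq1 ha ht, choose_succ_eq]
    ring

lemma tendsto_tsum_chooseQuot {x : ℂ_[p]} (hx : ‖x‖ = 1) :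
    Tendsto (fun y : ℂ_[p] => ∑' m, chooseQuot m y * seriesCoeff q F x (m + 1)) (𝓝 0)
      (𝓝 (∑' m, chooseQuot m 0 * seriesCoeff q F x (m + 1))) := by
  refine tendsto_tsum_of_dominated_convergence (summable_bound hpF) (fun m => ?_) ?_
  · exact ((continuous_chooseQuot m).tendsto 0).mul_const _
  · filter_upwards [Metric.closedBall_mem_nhds (0 : ℂ_[p]) one_pos] with y hy
    exact norm_chooseQuot_mul_seriesCoeff_le hq hq1 hF hpF hx (by simpa using hy)

/-- The derivative at `s = 1` of `⟨a + p^* t⟩^{1 - s} ∑ (1 - s choose m) …`. -/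
lemma tendsto_summand_slope {a : ℕ} (ha : a.Coprime p) {t : ℂ_[p]} (ht : ‖t‖ ≤ 1) :
    Tendsto (fun s : ℂ_[p] => (ppow (angle q a t) (1 - s) * ∑' m, LTerm q F a s t m
        - qBernoulli (q ^ F) 0) / (s - 1)) (𝓝[≠] 1)
      (𝓝 (-(qBernoulli (q ^ F) 0 * plog (angle q a t)) + ∑' m, oneTerm q F a t m)) := by
  set β := qBernoulli (q ^ F) 0
  set l := plog (angle q a t)
  set K : ℂ_[p] → ℂ_[p] := fun y => ∑' m, chooseQuot m y * seriesCoeff q F (pt a t) (m + 1)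
  have hK : Tendsto K (𝓝[≠] 0) (𝓝 (K 0)) :=
    (tendsto_tsum_chooseQuot hq hq1 hF hpF (norm_pt ha ht)).mono_left nhdsWithin_le_nhds
  have hone : ∑' m, oneTerm q F a t m = -K 0 := by
    simp only [oneTerm_eq, tsum_neg, K]
  have hd := hasDerivAt_exp_mul_zero l
  have hslope := hasDerivAt_iff_tendsto_slope_zero.mp hd
  have hE : Tendsto (fun y : ℂ_[p] => NormedSpace.exp (y * l)) (𝓝[≠] 0) (𝓝 1) := by
    have := hd.continuousAt.tendsto.mono_left (nhdsWithin_le_nhds (s := {0}ᶜ))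
    simpa [NormedSpace.exp_zero] using this
  have hsub : Tendsto (fun s : ℂ_[p] => 1 - s) (𝓝[≠] 1) (𝓝[≠] 0) := by
    refine tendsto_nhdsWithin_iff.mpr ⟨?_, ?_⟩
    · have : Tendsto (fun s : ℂ_[p] => 1 - s) (𝓝 1) (𝓝 (1 - 1)) :=
        tendsto_const_nhds.sub tendsto_id
      rw [sub_self] at this
      exact this.mono_left nhdsWithin_le_nhds
    · filter_upwards [self_mem_nhdsWithin] with s hs
      exact sub_ne_zero.mpr (Ne.symm hs)
  -- With `y = 1 - s`, the quotient is `-((exp(y l) - 1)/y * β + exp(y l) K(y))`. Only the behaviour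
  -- of `exp(y l)` as `y → 0` enters, so no bound on `l` is needed.
  have hmain := (((hslope.mul_const β).add (hE.mul hK)).neg).comp hsub
  have hlim : -(l * β + 1 * K 0) = -(β * l) + ∑' m, oneTerm q F a t m := by
    rw [hone]
    ring
  rw [hlim] at hmain
  refine hmain.congr' ?_
  have hball : ∀ᶠ s : ℂ_[p] in 𝓝[≠] 1, s ∈ Metric.closedBall (1 : ℂ_[p]) 1 :=
    nhdsWithin_le_nhds (Metric.closedBall_mem_nhds 1 one_pos)
  filter_upwards [hball, self_mem_nhdsWithin] with s hs hs1
  have hs' : ‖s - 1‖ ≤ 1 := by simpa [dist_eq_norm] using hs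
  have h1 : s - 1 ≠ 0 := sub_ne_zero.mpr hs1
  rw [tsum_LTerm_eq hq hq1 hF hpF ha ht hs']
  change -(((1 - s)⁻¹ • (NormedSpace.exp ((0 + (1 - s)) * l) - NormedSpace.exp (0 * l))) * β
    + NormedSpace.exp ((1 - s) * l) * K (1 - s)) =
    (NormedSpace.exp ((1 - s) * l) * (β + (1 - s) * K (1 - s)) - β) / (s - 1)
  rw [zero_add, zero_mul, NormedSpace.exp_zero, smul_eq_mul, eq_div_iff h1,
    show (1 - s)⁻¹ = -(s - 1)⁻¹ by rw [← inv_neg, neg_sub]]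
  field_simp
  ring

end terms

/-! ### Vanishing of the character sum -/

lemma sum_range_mul_of_periodic {R : Type*} [AddCommMonoid R] {g : ℕ → R} {M : ℕ}
    (hg : Function.Periodic g M) (k : ℕ) :
    ∑ a ∈ Finset.range (M * k), g a = k • ∑ a ∈ Finset.range M, g a := by
  induction k with
  | zero => simp
  | succ k ih =>
    rw [Nat.mul_succ, Finset.sum_range_add, ih, succ_nsmul]
    congr 1
    refine Finset.sum_congr rfl fun a _ => ?_
    rw [add_comm, mul_comm]
    exact hg.nat_mul k a

lemma sum_range_dirichletCharacter {R : Type*} [CommRing R] [IsDomain R] {M : ℕ} [NeZero M]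
    {χ : DirichletCharacter R M} (hχ : χ ≠ 1) : ∑ a ∈ Finset.range M, χ (a : ZMod M) = 0 := by
  rw [← MulChar.sum_eq_zero_of_ne_one hχ]
  refine Finset.sum_nbij' (fun a => (a : ZMod M)) ZMod.val (by simp) ?_ ?_ (by simp) (by simp)
  · intro x _
    exact Finset.mem_range.mpr x.val_lt
  · intro a ha
    exact ZMod.val_cast_of_lt (Finset.mem_range.mp ha)

/-- Raising `χ` to level `lcm(f, p)` builds in the condition `(a, p) = 1` and keeps it nontrivial;
`F` is a whole number of periods. -/
lemma sum_units_dirichletCharacter {f : ℕ} {χ : DirichletCharacter ℂ_[p] f} (hχ : χ ≠ 1) {F : ℕ}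
    (hF : 0 < F) (hpF : p ∣ F) (hfF : f ∣ F) : ∑ a ∈ units p F, χ (a : ZMod f) = 0 := by
  have hf : f ≠ 0 := fun h => hF.ne' (zero_dvd_iff.mp (h ▸ hfF))
  set M := f.lcm p
  have : NeZero M := ⟨Nat.lcm_ne_zero hf (Fact.out : p.Prime).ne_zero⟩
  have hfM : f ∣ M := Nat.dvd_lcm_left f p
  have hMF : M ∣ F := Nat.lcm_dvd hfF hpF
  set ψ := DirichletCharacter.changeLevel hfM χ
  have hψ : ψ ≠ 1 := fun h => hχ ((DirichletCharacter.changeLevel_eq_one_iff hfM).mp h)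
  have hval : ∀ a : ℕ, ψ (a : ZMod M) = if a.Coprime p then χ (a : ZMod f) else 0 := by
    intro a
    by_cases hu : a.Coprime M
    · have hap : a.Coprime p := hu.coprime_dvd_right (Nat.dvd_lcm_right f p)
      have h := DirichletCharacter.changeLevel_eq_cast_of_dvd χ hfM (ZMod.unitOfCoprime a hu)
      rw [ZMod.coe_unitOfCoprime, ZMod.cast_natCast hfM] at h
      rw [if_pos hap, ← h]
    · rw [ψ.map_nonunit (by rwa [ZMod.isUnit_iff_coprime])]
      split_ifs with hap
      · refine (χ.map_nonunit ?_).symm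
        rw [ZMod.isUnit_iff_coprime]
        exact fun haf => hu ((haf.mul_right hap).coprime_dvd_right (Nat.lcm_dvd_mul f p))
      · rfl
  have hper : Function.Periodic (fun a : ℕ => ψ (a : ZMod M)) M := fun a => by simp
  obtain ⟨k, rfl⟩ := hMF
  have hsum := sum_range_mul_of_periodic hper k
  rw [sum_range_dirichletCharacter hψ, smul_zero] at hsum
  rw [units, Finset.sum_filter]
  refine Eq.trans ?_ hsum
  refine (Finset.sum_congr rfl fun a _ => (hval a).symm).trans ?_
  rw [← Finset.Ico_add_one_right_eq_Icc, Finset.sum_Ico_eq_sum_range, Nat.add_sub_cancel]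
  -- Moves the range `1, …, F` to `0, …, F - 1`: the two end values agree modulo `M`.
  have h1 := Finset.sum_range_succ (fun a : ℕ => ψ (a : ZMod M)) (M * k)
  rw [Finset.sum_range_succ'] at h1
  have h2 : ψ ((M * k : ℕ) : ZMod M) = ψ ((0 : ℕ) : ZMod M) := by simp
  rw [h2, add_left_inj] at h1
  rw [← h1]
  exact Finset.sum_congr rfl fun a _ => by rw [add_comm]

lemma dvd_pStar : p ∣ pStar p := by
  rw [pStar]
  split_ifs with h
  · subst h
    norm_num
  · exact dvd_rfl

omit [Fact p.Prime] in
lemma coprime_of_mem_units {F a : ℕ} (h : a ∈ units p F) : a.Coprime p :=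
  (Finset.mem_filter.mp h).2

/-! ### The limit at `s = 1` -/

lemma tendsto_LFormula {q : ℂ_[p]} (hq : ‖q - 1‖ < expRadius p) (hq1 : q ≠ 1) {f : ℕ}
    {χ : DirichletCharacter ℂ_[p] f} (hχ : χ ≠ 1) {F : ℕ} (hF : 0 < F) (hpF : pStar p ∣ F)
    (hfF : f ∣ F) {t : ℂ_[p]} (ht : ‖t‖ ≤ 1) :
    Tendsto (fun s => LFormula q χ F s t) (𝓝[≠] 1)
      (𝓝 (1 / qNum q (F : ℂ_[p]) * ∑ a ∈ units p F, χ (a : ZMod f) *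
        (-(qBernoulli (q ^ F) 0 * plog (angle q a t)) + ∑' m : ℕ, oneTerm q F a t m))) := by
  have hlim := (tendsto_finsetSum (units p F) fun a ha =>
    (tendsto_summand_slope hq hq1 hF hpF (coprime_of_mem_units ha) ht).const_mul
      (χ (a : ZMod f))).const_mul (1 / qNum q (F : ℂ_[p]))
  refine hlim.congr fun s => ?_
  have h0 := sum_units_dirichletCharacter hχ hF (dvd_pStar.trans hpF) hfF
  have hsum : ∑ a ∈ units p F, χ (a : ZMod f) *
      ((ppow (angle q a t) (1 - s) * ∑' m, LTerm q F a s t m - qBernoulli (q ^ F) 0) / (s - 1)) =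
      1 / (s - 1) * ∑ a ∈ units p F, χ (a : ZMod f) * ppow (angle q a t) (1 - s) *
        ∑' m, LTerm q F a s t m := by
    -- The vanishing character sum, times `β_{0,q^F}`, is inserted here.
    rw [← sub_zero (∑ a ∈ units p F, χ (a : ZMod f) * ppow (angle q a t) (1 - s) *
        ∑' m, LTerm q F a s t m), ← zero_mul (qBernoulli (q ^ F) 0), ← h0, Finset.sum_mul,
      ← Finset.sum_sub_distrib, Finset.mul_sum]
    exact Finset.sum_congr rfl fun a _ => by ring
  rw [hsum, LFormula]
  ring

end KimPadicL

end

theorem theorem8 (p : ℕ) [Fact p.Prime] (q : ℂ_[p]) (hq1 : q ≠ 1)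
    (hq : ‖1 - q‖ < (p : ℝ) ^ (-(1 / ((p : ℝ) - 1))))
    {f : ℕ} (χ : DirichletCharacter ℂ_[p] f) (hχ : χ.IsPrimitive) (hχ1 : χ ≠ 1)
    (F : ℕ) (hF : 0 < F) (hpF : KimPadicL.pStar p ∣ F) (hfF : f ∣ F)
    (t : ℂ_[p]) (ht : ‖t‖ ≤ 1) :
    (∀ a ∈ KimPadicL.units p F,
      (∀ s : ℂ_[p], ‖s - 1‖ ≤ 1 → Summable (KimPadicL.LTerm q F a s t)) ∧
      Summable (KimPadicL.oneTerm q F a t)) ∧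
    Filter.Tendsto (fun s => KimPadicL.L q χ F s t) (nhdsWithin 1 {1}ᶜ)
      (nhds (KimPadicL.L q χ F 1 t)) ∧
    KimPadicL.L q χ F 1 t =
      1 / KimPadicL.qNum q (F : ℂ_[p]) *
        ∑ a ∈ KimPadicL.units p F, χ (a : ZMod f) *
          (-(KimPadicL.qBernoulli (q ^ F) 0 * KimPadicL.plog (KimPadicL.angle q a t))
            + ∑' m : ℕ, KimPadicL.oneTerm q F a t m) := by
  rw [norm_sub_rev] at hq
  have hlim := KimPadicL.tendsto_LFormula hq hq1 hχ1 hF hpF hfF ht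
  -- The value at `1` is a `limUnder`, meaningful because the limit was shown to exist.
  have hL : KimPadicL.L q χ F 1 t = _ := (if_pos rfl).trans hlim.limUnder_eq
  refine ⟨fun a ha => ⟨fun s hs => ?_, ?_⟩, ?_, hL⟩
  · exact KimPadicL.summable_LTerm hq hq1 hF hpF (KimPadicL.coprime_of_mem_units ha) ht hs
  · exact KimPadicL.summable_oneTerm hq hq1 hF hpF (KimPadicL.coprime_of_mem_units ha) ht
  · rw [hL]
    refine hlim.congr' ?_
    filter_upwards [self_mem_nhdsWithin] with s hs
    exact (if_neg hs).symm
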